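/- Let $N>k\ge 3$ be integers. For a real symmetric $N\times N$ matrix $X$ with eigenvalues $\lambda_1\le\dots\le\lambda_N$ (counted with multiplicity) let $\mathcal P_k^+(X)=\sum_{i=N-k+1}^N\lambda_i$ be the sum of its $k$ largest eigenvalues. Let $B(0,1)$ be the open unit ball of $\mathbb R^N$, let $r=|x|$, and define the radial principal eigenvalue of $\mathcal P_k^+$ for the potential $r^{-2}$ in $B(0,1)\setminus\{0\}$ by $$\bar\lambda_2=\sup\left\{\mu\in\mathbb R:\ \exists\, v\in C^2(B(0,1)\setminus\{0\}),\ v>0,\ v\text{ radial},\ \mathcal P_k^+(D^2v)+\mu\, v\, r^{-2}\le 0\ \text{in } B(0,1)\setminus\{0\}\right\}.$$ Then $$\bar\lambda_2=\frac{(k-2)^2}{4},$$ and the function $u(r)=\dfrac{-\ln r}{r^{(k-2)/2}}$ is an explicit positive radial solution, of class $C^2$ in $B(0,1)\setminus\{0\}$ and continuous on $\overline{B(0,1)}\setminus\{0\}$, of the Dirichlet problem $$\mathcal P_k^+(D^2u)+\bar\lambda_2\,\frac{u}{r^2}=0\ \text{ in } B(0,1)\setminus\{0\},\qquad u=0\ \text{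 on }\partial B(0,1).$$ -/

import Mathlib

noncomputable section

namespace TruncatedLaplacian

/-- The space `ℝ^N` with its Euclidean norm. -/
abbrev Space (N : ℕ) := EuclideanSpace ℝ (Fin N)

/-- The truncated Laplacian `P_k^+` : the sum of the `k` largest eigenvalues, counted with
multiplicity, of a real symmetric `N × N` matrix. Mathlib's `eigenvalues₀` lists the eigenvalues
in decreasing order, so the `k` largest ones are those of index `0, …, k - 1`.
(A real matrix is Hermitian exactly when it is symmetric; the value `0` at nonsymmetric matrices
is a convention that is never met at the Hessian of a `C²` function.) -/
def pkPlus {N : ℕ} (k : ℕ) (X : Matrix (Fin N) (Fin N) ℝ) : ℝ :=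
  open Classical in
  if h : X.IsHermitian then
    ∑ i : Fin (Fintype.card (Fin N)) with i.val < k, h.eigenvalues₀ i
  else 0

/-- The Hessian matrix `D²u(x) = (∂²u / ∂xᵢ ∂xⱼ (x))ᵢⱼ`. -/
def hessian {N : ℕ} (u : Space N → ℝ) (x : Space N) : Matrix (Fin N) (Fin N) ℝ :=
  Matrix.of fun i j =>
    fderiv ℝ (fderiv ℝ u) x (EuclideanSpace.single i 1) (EuclideanSpace.single j 1)

/-- The punctured unit ball `B(0,1) \ {0}`. -/
def puncturedBall (N : ℕ) : Set (Space N) := Metric.ball 0 1 \ {0}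

/-- `u` is radial on `s`: its value at a point of `s` depends only on the norm of the point. -/
def IsRadialOn {N : ℕ} (u : Space N → ℝ) (s : Set (Space N)) : Prop :=
  ∀ x ∈ s, ∀ y ∈ s, ‖x‖ = ‖y‖ → u x = u y

/-- `v` is a positive radial `C²` supersolution: `v > 0` and
`P_k^+(D²v) + μ v r^{-γ} ≤ 0` in `B(0,1) \ {0}`. -/
structure IsPositiveRadialSupersolution (N k : ℕ) (γ μ : ℝ) (v : Space N → ℝ) : Prop where
  contDiffOn : ContDiffOn ℝ 2 v (puncturedBall N)
  pos : ∀ x ∈ puncturedBall N, 0 < v x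
  radial : IsRadialOn v (puncturedBall N)
  le_zero : ∀ x ∈ puncturedBall N, pkPlus k (hessian v x) + μ * v x * ‖x‖ ^ (-γ) ≤ 0

/-- The radial principal eigenvalue of `P_k^+` for the potential `r^{-γ}` in `B(0,1) \ {0}`,
in the sense of Berestycki, Nirenberg and Varadhan: the supremum, in the extended reals, of all
real `μ` that admit a positive radial supersolution. -/
def radialPrincipalEigenvalue (N k : ℕ) (γ : ℝ) : EReal :=
  sSup ((fun μ : ℝ => (μ : EReal)) ''
    {μ : ℝ | ∃ v : Space N → ℝ, IsPositiveRadialSupersolution N k γ μ v})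

/-- `u` is a positive radial classical solution of the Dirichlet problem
`P_k^+(D²u) + lam u / r^γ = 0` in `B(0,1) \ {0}`, `u = 0` on `∂B(0,1)`. The function is continuous
up to the boundary sphere; nothing is required at the origin. -/
structure IsPositiveRadialEigenfunction (N k : ℕ) (γ lam : ℝ) (u : Space N → ℝ) : Prop where
  contDiffOn : ContDiffOn ℝ 2 u (puncturedBall N)
  continuousOn : ContinuousOn u (Metric.closedBall 0 1 \ {0})
  pos : ∀ x ∈ puncturedBall N, 0 < u x
  radial : IsRadialOn u (puncturedBall N)
  eq_zero : ∀ x ∈ puncturedBall N, pkPlus k (hessian u x) + lam * (u x / ‖x‖ ^ γ) = 0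
  boundary : ∀ x ∈ Metric.sphere (0 : Space N) 1, u x = 0

end TruncatedLaplacian

end

/-!
A radial function has the form `p (log r)`, and its Hessian at `x` is
`(p' / r ^ 2) • 1 + ((p'' - 2 p') / r ^ 4) • x xᵀ` (`hessian_comp_log_norm`). It has one radial
eigenvalue `(p'' - p') / r ^ 2` and `N - 1` tangential eigenvalues `p' / r ^ 2`, so `r ^ 2 P_k^+` is
at least `p'' + (k - 2) p'`, with equality when the radial eigenvalue is the largest one
(`pkPlus_smul_one_add_smul_vecMulVec`). The logarithmic variable thus turns the inequality for
supersolutions with potential `r ^ (-2)` into one with constant coefficients,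
`p'' + (k - 2) p' + m p ≤ 0` on the half-line `t < 0`.

Put `a = (k - 2) / 2`. For `m > a ^ 2` the equation `p'' + 2 a p' + m p = 0` oscillates, and a
Wronskian argument on one half-period, which fits into the half-line, excludes positive
supersolutions (`frequency_le_of_positive_supersolution`). For `m = a ^ 2` the profile
`-t * exp (-a t)` is an exact solution, positive on `t < 0`, with `2 p' ≤ p''`, so the radial
eigenvalue is the largest and the lower bound for `P_k^+` is an equality
(`isPositiveRadialEigenfunction`). Hence the supremum is `a ^ 2`, and it is attained.
-/

namespace TruncatedLaplacian

/-! ### Sums of the largest eigenvalues -/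

/-- A decreasing family taking the values `b` and `b + d`, whose sum is that of one term `b + d` and
`n - 1` terms `b`: its first `k` terms sum to at least `k * b + d`, with equality when the
exceptional term `b + d` is the largest. -/
theorem sum_largest_of_two_values {n k : ℕ} (hk : 1 ≤ k) (hkn : k ≤ n) {l : Fin n → ℝ}
    (hl : Antitone l) {b d : ℝ} (hval : ∀ i, l i = b ∨ l i = b + d)
    (hsum : ∑ i, l i = n * b + d) :
    k * b + d ≤ ∑ i : Fin n with i.val < k, l i ∧
      (0 ≤ d → ∑ i : Fin n with i.val < k, l i = k * b + d) := by
  have hcard : (Finset.univ.filter fun i : Fin n => i.val < k).card = k := by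
    rw [Fin.card_filter_val_lt, min_eq_right hkn]
  have hshift : ∑ i : Fin n with i.val < k, (l i - b) =
      ∑ i : Fin n with i.val < k, l i - k * b := by
    rw [Finset.sum_sub_distrib, Finset.sum_const, hcard, nsmul_eq_mul]
  have htotal : ∑ i : Fin n, (l i - b) = d := by
    rw [Finset.sum_sub_distrib, hsum, Finset.sum_const, Finset.card_univ, Fintype.card_fin,
      nsmul_eq_mul]
    ring
  -- The differences `l i - b` all have the sign of `d` and sum to `d`. For `0 ≤ d` the first one
  -- already equals `d`; for `d < 0` every partial sum is at least the total.
  rcases le_or_gt 0 d with hd | hd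
  · have hnonneg : ∀ i, 0 ≤ l i - b := fun i => by
      rcases hval i with h | h <;> rw [h] <;> linarith
    let z : Fin n := ⟨0, by omega⟩
    have hz : l z - b = d := by
      rcases hval z with h | h
      · have : ∑ i : Fin n, (l i - b) ≤ 0 := Finset.sum_nonpos fun i _ => by
          have := hl (show z ≤ i from Nat.zero_le _)
          linarith
        linarith
      · linarith
    have hge : d ≤ ∑ i : Fin n with i.val < k, (l i - b) := by
      rw [← hz]
      exact Finset.single_le_sum (f := fun i => l i - b) (fun i _ => hnonneg i)
        (by simp [z]; omega)
    have hle : ∑ i : Fin n with i.val < k, (l i - b) ≤ d := by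
      rw [← htotal]
      exact Finset.sum_le_univ_sum_of_nonneg hnonneg
    exact ⟨by linarith, fun _ => by linarith⟩
  · have hle : ∑ i : Fin n with i.val < k, (b - l i) ≤ ∑ i : Fin n, (b - l i) :=
      Finset.sum_le_univ_sum_of_nonneg fun i => by
        rcases hval i with h | h <;> rw [h] <;> linarith
    have hneg : ∀ s : Finset (Fin n), ∑ i ∈ s, (b - l i) = -∑ i ∈ s, (l i - b) := fun s => by
      rw [← Finset.sum_neg_distrib]
      exact Finset.sum_congr rfl fun i _ => by ring
    rw [hneg, hneg] at hle
    exact ⟨by linarith, fun h => absurd h hd.not_ge⟩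

/-- The matrix `b • 1 + c • x xᵀ` has the simple eigenvalue `b + c ‖x‖²`, with eigenvector `x`, and
the eigenvalue `b` on the orthogonal complement of `x`. -/
theorem pkPlus_smul_one_add_smul_vecMulVec {N k : ℕ} (hk : 1 ≤ k) (hkN : k ≤ N) (b c : ℝ)
    (x : Space N) :
    let X : Matrix (Fin N) (Fin N) ℝ := b • 1 + c • Matrix.vecMulVec x x
    k * b + c * ‖x‖ ^ 2 ≤ pkPlus k X ∧
      (0 ≤ c * ‖x‖ ^ 2 → pkPlus k X = k * b + c * ‖x‖ ^ 2) := by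
  intro X
  have hX : X.IsHermitian := by
    ext i j
    simp [X, Matrix.one_apply, Matrix.vecMulVec_apply, eq_comm, mul_comm]
  have hnorm : ‖x‖ ^ 2 = x.ofLp ⬝ᵥ x.ofLp := by
    rw [EuclideanSpace.real_norm_sq_eq]
    simp [dotProduct, sq]
  have hmul : ∀ v : Fin N → ℝ, X.mulVec v = b • v + (c * (x.ofLp ⬝ᵥ v)) • x.ofLp := fun v => by
    simp only [X, Matrix.add_mulVec, Matrix.smul_mulVec, Matrix.one_mulVec,
      Matrix.vecMulVec_mulVec]
    ext i
    simp
    ring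
  have hval' : ∀ i, hX.eigenvalues i = b ∨ hX.eigenvalues i = b + c * ‖x‖ ^ 2 := fun i => by
    have h := hX.mulVec_eigenvectorBasis i
    rw [hmul] at h
    set v := hX.eigenvectorBasis i with hv
    have hdot := congrArg (fun w => x.ofLp ⬝ᵥ w) h
    simp only [dotProduct_add, dotProduct_smul, smul_eq_mul] at hdot
    rw [← hnorm] at hdot
    -- An eigenvector not orthogonal to `x` can only belong to the eigenvalue `b + c * ‖x‖ ^ 2`.
    have hprod : (b + c * ‖x‖ ^ 2 - hX.eigenvalues i) * (x.ofLp ⬝ᵥ v.ofLp) = 0 := by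
      linear_combination hdot
    rcases mul_eq_zero.1 hprod with h0 | h0
    · right; linarith
    · left
      rw [h0, mul_zero, zero_smul, add_zero] at h
      have hne : v.ofLp ≠ 0 := fun h => by
        have h1 : ‖v‖ = 1 := hX.eigenvectorBasis.orthonormal.1 i
        have : v = 0 := by ext j; exact congrFun h j
        rw [this] at h1; simp at h1
      exact (smul_left_injective ℝ hne h).symm
  have hval : ∀ i, hX.eigenvalues₀ i = b ∨ hX.eigenvalues₀ i = b + c * ‖x‖ ^ 2 := fun i => by
    have := hval' (Fintype.equivOfCardEq (Fintype.card_fin _) i)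
    simpa [Matrix.IsHermitian.eigenvalues] using this
  have hsum : ∑ i, hX.eigenvalues₀ i = (Fintype.card (Fin N) : ℕ) * b + c * ‖x‖ ^ 2 := by
    have h1 : ∑ i, hX.eigenvalues₀ i = ∑ i, hX.eigenvalues i :=
      (Equiv.sum_comp (Fintype.equivOfCardEq (Fintype.card_fin _)).symm hX.eigenvalues₀).symm
    have h2 : X.trace = ∑ i, hX.eigenvalues i := by
      simpa using hX.trace_eq_sum_eigenvalues
    rw [h1, ← h2, hnorm]
    simp [X, Matrix.trace_add, Matrix.trace_smul, Matrix.trace_vecMulVec, mul_comm]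
  have key := sum_largest_of_two_values hk (by simpa using hkN) hX.eigenvalues₀_antitone hval hsum
  simpa only [pkPlus, dif_pos hX] using key

/-! ### The Hessian of a radial function -/

/-- The Hessian of a radial function written as `p (log r)`. In this variable the radial eigenvalue
is `(p'' - p') / r ^ 2` and the tangential one is `p' / r ^ 2`. -/
theorem hessian_comp_log_norm {N : ℕ} {v : Space N → ℝ} {p p' : ℝ → ℝ} {p'' : ℝ} {x : Space N}
    (hx : x ≠ 0) (hv : v =ᶠ[nhds x] fun y => p (Real.log ‖y‖))
    (hp : ∀ᶠ t in nhds (Real.log ‖x‖), HasDerivAt p (p' t) t)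
    (hp' : HasDerivAt p' p'' (Real.log ‖x‖)) :
    hessian v x = (p' (Real.log ‖x‖) / ‖x‖ ^ 2) • 1 +
      ((p'' - 2 * p' (Real.log ‖x‖)) / ‖x‖ ^ 4) • Matrix.vecMulVec x x := by
  have hlog : ∀ y : Space N, y ≠ 0 → HasFDerivAt (fun y : Space N => Real.log ‖y‖)
      ((‖y‖ ^ 2)⁻¹ • innerSL ℝ y) y := fun y hy => by
    have h1 := ((hasStrictFDerivAt_norm_sq y).hasFDerivAt.log (by positivity)).const_mul (1 / 2 : ℝ)
    refine (h1.congr_fderiv ?_).congr_of_eventuallyEq (Filter.Eventually.of_forall fun z => ?_)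
    · ext w; simp; ring
    · simp [Real.log_pow]
  have hcont : Filter.Tendsto (fun y : Space N => Real.log ‖y‖) (nhds x)
      (nhds (Real.log ‖x‖)) := (hlog x hx).continuousAt
  have hfd : fderiv ℝ v =ᶠ[nhds x]
      fun y => (p' (Real.log ‖y‖) * (‖y‖ ^ 2)⁻¹) • innerSL ℝ y := by
    filter_upwards [hv.eventually_nhds, hcont.eventually hp, isOpen_ne.mem_nhds hx]
      with y hy hpy hy0
    rw [Filter.EventuallyEq.fderiv_eq hy]
    have := (hpy.comp_hasFDerivAt y (hlog y hy0)).fderiv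
    rw [Function.comp_def] at this
    rw [this, smul_smul]
  have hn : ‖x‖ ≠ 0 := norm_ne_zero_iff.2 hx
  have hinv : HasFDerivAt (fun y : Space N => (‖y‖ ^ 2)⁻¹)
      ((-(‖x‖ ^ 2 ^ 2)⁻¹) • ((2 : ℝ) • innerSL ℝ x)) x := by
    have := (hasDerivAt_inv (pow_ne_zero 2 hn)).comp_hasFDerivAt x
      (hasStrictFDerivAt_norm_sq x).hasFDerivAt
    refine this.congr_fderiv ?_
    ext w; simp; ring_nf; simp
  -- `innerSL ℝ` is conjugate-linear by type; `L` is the same map, typed as `ℝ`-linear.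
  obtain ⟨L, hL⟩ : ∃ L : Space N →L[ℝ] Space N →L[ℝ] ℝ, ∀ y, L y = innerSL ℝ y :=
    ⟨innerSL ℝ, fun _ => rfl⟩
  have hinner : HasFDerivAt (fun y : Space N => innerSL ℝ y) L x := by
    simp only [← hL]
    exact L.hasFDerivAt
  have hd := hfd.fderiv_eq.trans
    (((hp'.comp_hasFDerivAt x (hlog x hx)).mul hinv).smul hinner).fderiv
  ext i j
  have hij : (innerSL ℝ (EuclideanSpace.single i (1 : ℝ))) (EuclideanSpace.single j 1) =
      if i = j then (1 : ℝ) else 0 := by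
    simp [EuclideanSpace.inner_single_left]
  simp only [hessian, Matrix.of_apply, hd]
  simp only [Function.comp_apply, hL, hij, Pi.mul_apply, _root_.add_apply,
    _root_.smul_apply, ContinuousLinearMap.smulRight_apply, innerSL_apply_apply,
    EuclideanSpace.inner_single_right, smul_eq_mul, Matrix.add_apply, Matrix.smul_apply,
    Matrix.vecMulVec_apply, Matrix.one_apply, conj_trivial, one_mul]
  field_simp
  ring

/-! ### Sturm comparison -/

/-- Sturm comparison on the half-line `t < 0`: if `p'' + 2 a p' + m p ≤ 0` has a positive solution,
then `m ≤ a ^ 2`. Otherwise `m = a ^ 2 + w ^ 2` with `0 < w`, and the weighted Wronskian of `p` with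
the oscillating solution `exp (-a t) * sin (w (t - T))` decreases on a half-period, although
positivity of `p` makes it negative at the left end and positive at the right end. -/
theorem frequency_le_of_positive_supersolution {a m : ℝ} {p p' p'' : ℝ → ℝ}
    (hp : ∀ t < 0, HasDerivAt p (p' t) t) (hp' : ∀ t < 0, HasDerivAt p' (p'' t) t)
    (hpos : ∀ t < 0, 0 < p t) (hle : ∀ t < 0, p'' t + 2 * a * p' t + m * p t ≤ 0) :
    m ≤ a ^ 2 := by
  by_contra! hm
  set w := Real.sqrt (m - a ^ 2) with hw
  have hw0 : 0 < w := Real.sqrt_pos.2 (by linarith)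
  have hw2 : w ^ 2 = m - a ^ 2 := Real.sq_sqrt (by linarith)
  -- The half-period `[T, -1]` has length `π / w` and lies inside the half-line `t < 0`.
  set T : ℝ := -1 - Real.pi / w with hT
  have hTlt : T < -1 := by have := div_pos Real.pi_pos hw0; linarith
  have hwT : w * (-1 - T) = Real.pi := by rw [hT]; field_simp; ring
  let g : ℝ → ℝ := fun t => Real.exp (a * t) *
    ((p' t + a * p t) * Real.sin (w * (t - T)) - p t * (w * Real.cos (w * (t - T))))
  have hg : ∀ t < 0, HasDerivAt g (Real.exp (a * t) * Real.sin (w * (t - T)) *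
      (p'' t + 2 * a * p' t + m * p t)) t := fun t ht => by
    have harg : HasDerivAt (fun t => w * (t - T)) w t := by
      simpa using ((hasDerivAt_id t).sub_const T).const_mul w
    have hexp : HasDerivAt (fun t => Real.exp (a * t)) (Real.exp (a * t) * a) t := by
      simpa using ((hasDerivAt_id t).const_mul a).exp
    have := hexp.mul ((((hp' t ht).add ((hp t ht).const_mul a)).mul harg.sin).sub
      ((hp t ht).mul (harg.cos.const_mul w)))
    refine this.congr_deriv ?_
    simp only [Pi.add_apply, Pi.mul_apply, Pi.sub_apply]
    linear_combination (Real.exp (a * t) * Real.sin (w * (t - T)) * p t) * hw2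
  have hanti : AntitoneOn g (Set.Icc T (-1)) := by
    refine antitoneOn_of_hasDerivWithinAt_nonpos (convex_Icc _ _)
      (fun t ht => (hg t (by linarith [ht.2])).continuousAt.continuousWithinAt)
      (fun t ht => (hg t ?_).hasDerivWithinAt) (fun t ht => ?_)
    · rw [interior_Icc] at ht; linarith [ht.2]
    · rw [interior_Icc] at ht
      refine mul_nonpos_of_nonneg_of_nonpos (mul_nonneg (Real.exp_pos _).le ?_)
        (hle t (by linarith [ht.2]))
      refine Real.sin_nonneg_of_nonneg_of_le_pi (mul_nonneg hw0.le (by linarith [ht.1])) ?_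
      rw [← hwT]
      exact mul_le_mul_of_nonneg_left (by linarith [ht.2]) hw0.le
  have h := hanti (Set.left_mem_Icc.2 hTlt.le) (Set.right_mem_Icc.2 hTlt.le) hTlt.le
  simp only [g, hwT, sub_self, mul_zero, Real.sin_zero, Real.cos_zero, Real.sin_pi,
    Real.cos_pi] at h
  have h1 := mul_pos (Real.exp_pos (a * T)) (mul_pos (hpos T (by linarith)) hw0)
  have h2 := mul_pos (Real.exp_pos (a * (-1))) (mul_pos (hpos (-1) (by norm_num)) hw0)
  linarith

/-! ### Supersolutions -/

theorem mem_puncturedBall {N : ℕ} {x : Space N} :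
    x ∈ puncturedBall N ↔ ‖x‖ < 1 ∧ x ≠ 0 := by
  simp [puncturedBall]

theorem log_norm_neg {N : ℕ} {x : Space N} (hx : x ∈ puncturedBall N) : Real.log ‖x‖ < 0 :=
  Real.log_neg (norm_pos_iff.2 (mem_puncturedBall.1 hx).2) (mem_puncturedBall.1 hx).1

theorem isOpen_puncturedBall (N : ℕ) : IsOpen (puncturedBall N) :=
  Metric.isOpen_ball.sdiff isClosed_singleton

/-- A positive radial supersolution bounds its `m`: since `P_k^+` is at least the sum of the radial
eigenvalue and `k - 1` tangential ones, its profile in `t = log r` satisfies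
`p'' + (k - 2) p' + m p ≤ 0` on `t < 0`. -/
theorem IsPositiveRadialSupersolution.le {N k : ℕ} {m : ℝ} {v : Space N → ℝ} (hk : 1 ≤ k)
    (hkN : k ≤ N) (h : IsPositiveRadialSupersolution N k 2 m v) :
    m ≤ (((k : ℝ) - 2) / 2) ^ 2 := by
  let e : Space N := EuclideanSpace.single ⟨0, by omega⟩ 1
  have he : ‖e‖ = 1 := by simp [e]
  have hnorm : ∀ t, ‖Real.exp t • e‖ = Real.exp t := fun t => by
    rw [norm_smul, he, mul_one, Real.norm_of_nonneg (Real.exp_pos t).le]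
  have hmem : ∀ t < 0, Real.exp t • e ∈ puncturedBall N := fun t ht => by
    rw [mem_puncturedBall, ← norm_ne_zero_iff, hnorm]
    exact ⟨by simpa using ht, (Real.exp_pos t).ne'⟩
  let p : ℝ → ℝ := fun t => v (Real.exp t • e)
  have hpC : ContDiffOn ℝ 2 p (Set.Iio 0) := by
    refine h.contDiffOn.comp (t := puncturedBall N) ?_ hmem
    exact (Real.contDiff_exp.smul contDiff_const).contDiffOn
  have hpd : ∀ t < 0, HasDerivAt p (deriv p t) t := fun t ht =>
    ((hpC.differentiableOn (by norm_num)).differentiableAt (Iio_mem_nhds ht)).hasDerivAt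
  have hpC' : ContDiffOn ℝ 1 (deriv p) (Set.Iio 0) :=
    hpC.deriv_of_isOpen isOpen_Iio (by norm_num)
  have hpd' : ∀ t < 0, HasDerivAt (deriv p) (deriv (deriv p) t) t := fun t ht =>
    ((hpC'.differentiableOn (by norm_num)).differentiableAt (Iio_mem_nhds ht)).hasDerivAt
  refine frequency_le_of_positive_supersolution hpd hpd' (fun t ht => h.pos _ (hmem t ht))
    fun t ht => ?_
  have hlogt : Real.log ‖Real.exp t • e‖ = t := by rw [hnorm, Real.log_exp]
  have hvp : v =ᶠ[nhds (Real.exp t • e)] fun y => p (Real.log ‖y‖) := by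
    filter_upwards [(isOpen_puncturedBall N).mem_nhds (hmem t ht)] with y hy
    refine h.radial y hy _ (hmem _ (log_norm_neg hy)) ?_
    rw [hnorm, Real.exp_log (norm_pos_iff.2 (mem_puncturedBall.1 hy).2)]
  have hH := hessian_comp_log_norm (p' := deriv p) (p'' := deriv (deriv p) t)
    (mem_puncturedBall.1 (hmem t ht)).2 hvp
    (by rw [hlogt]; filter_upwards [Iio_mem_nhds ht] with s hs using hpd s hs)
    (by rw [hlogt]; exact hpd' t ht)
  have hle := h.le_zero _ (hmem t ht)
  rw [hH] at hle
  have hge := (pkPlus_smul_one_add_smul_vecMulVec hk hkN _ _ _).1.trans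
    (le_sub_iff_add_le.2 hle)
  rw [hlogt, hnorm, Real.rpow_neg (Real.exp_pos t).le, Real.rpow_two] at hge
  field_simp at hge
  change _ + 2 * (((k : ℝ) - 2) / 2) * _ + m * v (Real.exp t • e) ≤ 0
  linarith

/-! ### The explicit eigenfunction -/

theorem hasDerivAt_neg_mul_exp (a t : ℝ) :
    HasDerivAt (fun t => -t * Real.exp (-(a * t))) ((a * t - 1) * Real.exp (-(a * t))) t := by
  have := (hasDerivAt_id t).neg.mul ((hasDerivAt_id t).const_mul a).neg.exp
  refine this.congr_deriv ?_
  simp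
  ring

theorem hasDerivAt_deriv_neg_mul_exp (a t : ℝ) :
    HasDerivAt (fun t => (a * t - 1) * Real.exp (-(a * t)))
      ((2 * a - a ^ 2 * t) * Real.exp (-(a * t))) t := by
  have := (((hasDerivAt_id t).const_mul a).sub_const 1).mul
    ((hasDerivAt_id t).const_mul a).neg.exp
  refine this.congr_deriv ?_
  simp
  ring

/-- In the variable `t = log r`, with `a = (k - 2) / 2`, the function has the profile
`-t * exp (-a t)`, a solution of `p'' + 2 a p' + a ^ 2 p = 0`. -/
theorem isPositiveRadialEigenfunction {N k : ℕ} (hk : 2 ≤ k) (hkN : k ≤ N) :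
    IsPositiveRadialEigenfunction N k 2 (((k : ℝ) - 2) ^ 2 / 4)
      (fun x => -Real.log ‖x‖ / ‖x‖ ^ (((k : ℝ) - 2) / 2)) := by
  obtain ⟨a, ha⟩ : ∃ a : ℝ, a = ((k : ℝ) - 2) / 2 := ⟨_, rfl⟩
  have ha0 : 0 ≤ a := by
    have : (2 : ℝ) ≤ k := by exact_mod_cast hk
    rw [ha]; linarith
  rw [← ha, show ((k : ℝ) - 2) ^ 2 / 4 = a ^ 2 by rw [ha]; ring]
  have hrep : ∀ x : Space N, x ≠ 0 → -Real.log ‖x‖ / ‖x‖ ^ a =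
      -Real.log ‖x‖ * Real.exp (-(a * Real.log ‖x‖)) := fun x hx => by
    rw [Real.rpow_def_of_pos (norm_pos_iff.2 hx), Real.exp_neg, div_eq_mul_inv,
      mul_comm a]
  have hsmooth : ∀ x : Space N, x ≠ 0 →
      ContDiffAt ℝ 2 (fun x : Space N => -Real.log ‖x‖ / ‖x‖ ^ a) x := fun x hx => by
    have hn := norm_pos_iff.2 hx
    exact ((contDiffAt_norm ℝ hx).log hn.ne').neg.div
      ((contDiffAt_norm ℝ hx).rpow_const_of_ne hn.ne') (Real.rpow_pos_of_pos hn a).ne'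
  refine ⟨fun x hx => (hsmooth x (mem_puncturedBall.1 hx).2).contDiffWithinAt,
    fun x hx => (hsmooth x hx.2).continuousAt.continuousWithinAt,
    fun x hx => div_pos (neg_pos.2 (log_norm_neg hx))
      (Real.rpow_pos_of_pos (norm_pos_iff.2 (mem_puncturedBall.1 hx).2) a),
    fun x _ y _ hxy => by simp only [hxy], fun x hx => ?_, fun x hx => ?_⟩
  · have hx0 := (mem_puncturedBall.1 hx).2
    have hn := norm_pos_iff.2 hx0
    have ht := log_norm_neg hx
    have hH := hessian_comp_log_norm (v := fun x : Space N => -Real.log ‖x‖ / ‖x‖ ^ a) hx0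
      (by filter_upwards [isOpen_ne.mem_nhds hx0] with y hy using hrep y hy)
      (Filter.Eventually.of_forall (hasDerivAt_neg_mul_exp a))
      (hasDerivAt_deriv_neg_mul_exp a _)
    rw [hH, hrep x hx0, (pkPlus_smul_one_add_smul_vecMulVec (by omega) hkN _ _ _).2,
      Real.rpow_two]
    · have hk' : (k : ℝ) = 2 * a + 2 := by rw [ha]; ring
      rw [hk']
      field_simp
      ring
    -- The radial eigenvalue is at least the tangential one: `2 * p' ≤ p''` for `t < 0`.
    · refine mul_nonneg (div_nonneg ?_ (by positivity)) (by positivity)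
      have hE := Real.exp_pos (-(a * Real.log ‖x‖))
      have : 0 ≤ (2 * a + 2 + (a ^ 2 + 2 * a) * -Real.log ‖x‖) *
          Real.exp (-(a * Real.log ‖x‖)) := by
        have := neg_pos.2 ht
        positivity
      linarith
  · simp [mem_sphere_zero_iff_norm.1 hx]

theorem IsPositiveRadialEigenfunction.isPositiveRadialSupersolution {N k : ℕ} {γ m : ℝ}
    {u : Space N → ℝ} (h : IsPositiveRadialEigenfunction N k γ m u) :
    IsPositiveRadialSupersolution N k γ m u where
  contDiffOn := h.contDiffOn
  pos := h.pos
  radial := h.radial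
  le_zero x hx := by
    rw [Real.rpow_neg (norm_nonneg x), mul_assoc, ← div_eq_mul_inv]
    exact (h.eq_zero x hx).le

end TruncatedLaplacian

theorem mainTheorem5 (N k : ℕ) (hk : 3 ≤ k) (hkN : k < N) :
    TruncatedLaplacian.radialPrincipalEigenvalue N k 2 =
        ((((k : ℝ) - 2) ^ 2 / 4 : ℝ) : EReal) ∧
      TruncatedLaplacian.IsPositiveRadialEigenfunction N k 2 (((k : ℝ) - 2) ^ 2 / 4)
        (fun x => -Real.log ‖x‖ / ‖x‖ ^ (((k : ℝ) - 2) / 2)) := by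
  have hu := TruncatedLaplacian.isPositiveRadialEigenfunction (N := N) (k := k) (by omega) hkN.le
  refine ⟨le_antisymm (sSup_le ?_) (le_sSup ?_), hu⟩
  · rintro _ ⟨m, ⟨v, hv⟩, rfl⟩
    have := hv.le (by omega) hkN.le
    exact EReal.coe_le_coe_iff.2 (by linarith)
  · exact ⟨_, ⟨_, hu.isPositiveRadialSupersolution⟩, rfl⟩
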